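/- For a probability distribution $p$ on $\mathbb{Z}_+=\{0,1,2,\dots\}$ let $G_p(s)=\sum_{k\ge 0}s^k p(k)$ be its generating function, let $\eta(p)=\min\{s\in[0,1]: G_p(s)=s\}$ be the smallest fixed point of $G_p$ in $[0,1]$ (the extinction probability of a Galton–Watson process with offspring distribution $p$), and let $\zeta(p)=1-\eta(p)$. If $p$ has mean $m_1(p)=\sum_k k\,p(k)\in(0,\infty)$, let $p^\circ$ be the downshifted size-biased distribution $p^\circ(k)=(k+1)p(k+1)/m_1(p)$, $k\ge 0$, and set \[ \zeta_{\rm CM}(p)=1-G_p(\eta(p^\circ)). \] For a probability distribution $\mu$ on $[0,\infty)$ let $\operatorname{MPoi}(\mu)$ be the mixed Poisson distribution with mass function $k\mapsto\int e^{-x}\frac{x^k}{k!}\,\mu(dx)$, let $\operatorname{Par}(\alpha,c)$ be the Pareto distribution with shape $\alpha$ and scale $c$, i.e. with density $\alpha c^\alpha t^{-\alpha-1}1(t>c)$, and let $\operatorname{Poi}(x)$ be the Poisson distribution with mean $x$. Define \[ \lambda_{\rm cr}=\inf\{x\ge 0:\ x\,\zeta(\operatorname{Poi}(x))=2\}, \]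 and, for $\lambda>0$ and $\alpha>1$, let $p_\alpha=\operatorname{MPoi}\bigl(\operatorname{Par}(\alpha,\lambda(1-1/\alpha))\bigr)$ (the scale being chosen so that the mean is $\lambda$). **Theorem.** For any $\lambda>\lambda_{\rm cr}$ there exists a constant $\alpha_{\rm cr}>1$ such that \[ \zeta_{\rm CM}(p_\alpha)\le\zeta_{\rm CM}(p_\beta)\le\zeta_{\rm CM}(\operatorname{Poi}(\lambda)) \qquad\text{for all } \alpha_{\rm cr}\le\alpha\le\beta . \] -/

import Mathlib

open MeasureTheory ProbabilityTheory
open scoped ENNReal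

namespace BranchingCM

/-- The mean `m₁(p) = ∑ k p(k)` of a distribution `p` on the nonnegative integers. -/
noncomputable def mean (p : Measure ℕ) : ℝ≥0∞ := ∑' k : ℕ, (k : ℝ≥0∞) * p {k}

/-- The size biasing `p*` of `p`: the distribution with mass function `p*(k) = k p(k) / m₁(p)`
(meaningful when `0 < m₁(p) < ∞`). -/
noncomputable def sizeBias (p : Measure ℕ) : Measure ℕ :=
  Measure.sum fun k : ℕ => ((k : ℝ≥0∞) * p {k} / mean p) • Measure.dirac k

/-- The downshifted size biasing `p°` of `p`: the distribution with mass function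
`p°(k) = p*(k + 1)`. -/
noncomputable def downshiftedSizeBias (p : Measure ℕ) : Measure ℕ :=
  Measure.sum fun k : ℕ => (sizeBias p {k + 1}) • Measure.dirac k

/-- The generating function `G_p(s) = ∑ s^k p(k)`, used for `s ∈ [0,1]`. -/
noncomputable def genFun (p : Measure ℕ) (s : ℝ) : ℝ := ∑' k : ℕ, s ^ k * p.real {k}

/-- `η(p)`: the smallest fixed point of `G_p` in `[0,1]`. -/
noncomputable def extinctionProb (p : Measure ℕ) : ℝ :=
  sInf {s : ℝ | s ∈ Set.Icc (0 : ℝ) 1 ∧ genFun p s = s}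

/-- `ζ(p) = 1 - η(p)`. -/
noncomputable def survivalProb (p : Measure ℕ) : ℝ := 1 - extinctionProb p

/-- The configuration model branching functional `ζ_CM(p) = 1 - G_p(η(p°))`. -/
noncomputable def zetaCM (p : Measure ℕ) : ℝ :=
  1 - genFun p (extinctionProb (downshiftedSizeBias p))

/-- The Poisson distribution with mean `x ≥ 0`. -/
noncomputable def poi (x : ℝ) : Measure ℕ := poissonMeasure x.toNNReal

/-- The mixed Poisson distribution `MPoi(μ)`, for a probability distribution `μ` on the
nonnegative reals: its mass at `k` is `∫ e^{-x} x^k / k! μ(dx)`. -/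
noncomputable def mixedPoi (μ : Measure ℝ) : Measure ℕ :=
  Measure.sum fun k : ℕ => (∫⁻ x, poi x {k} ∂μ) • Measure.dirac k

/-- The Pareto-mixed Poisson distribution `p_α = MPoi(Par(α, lam (1 - 1/α)))` with shape `α`
and scale `lam (1 - 1/α)` (Mathlib's `paretoMeasure` takes the scale first). -/
noncomputable def paretoMixedPoi (lam α : ℝ) : Measure ℕ :=
  mixedPoi (paretoMeasure (lam * (1 - 1 / α)) α)

/-- `λ_cr = inf {x ≥ 0 : x ζ(Poi(x)) = 2}`. -/
noncomputable def lambdaCr : ℝ := sInf {x : ℝ | 0 ≤ x ∧ x * survivalProb (poi x) = 2}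

end BranchingCM

namespace BranchingCM

/-! ### Mass functions and generating functions of mixed Poisson distributions -/

/-! With `ε = 1/α`, all the Pareto mixing laws are realised on one exponential variable `t` as `X_ε
= lam (1 - ε) e^{εt}`; `ε = 0` gives the constant `lam`, that is, the Poisson case. Any two of these
curves cross once and have the same mean, so `X_ε` increases in convex order with `ε`
(`integral_comp_expPareto_mono`).

The generating functions at `s = 1 - u` are `E e^{-uX}` for `p` and `E[X e^{-uX}] / lam` for `p°`.
The first integrand is convex in `X`, but `x e^{-ux}` is convex only for `x ≥ 2/u`. Since `X_ε ≥ lam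
(1 - ε)`, convexity on the support requires `lam (1 - ε) u ≥ 2`, and it is enough to have this at
the extinction probability of the larger parameter. The crude bound `G_{p°}(s) ≤ exp(-lam (1 - ε)(1
- s))` makes that probability small enough once `lam (1 - ε) ≥ 2 / (1 - e⁻²)`. As `lambdaCr` is at
least this constant, every `lam > lambdaCr` leaves room for small positive `ε`. -/

lemma poi_singleton {x : ℝ} (hx : 0 ≤ x) (k : ℕ) :
    poi x {k} = ENNReal.ofReal (Real.exp (-x) * x ^ k / (k.factorial : ℝ)) := by
  rw [poi, poissonMeasure_singleton, Real.coe_toNNReal _ hx]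

lemma measurable_poi_singleton (k : ℕ) : Measurable fun x : ℝ => poi x {k} := by
  simp only [poi, poissonMeasure_singleton]
  fun_prop

lemma mixedPoi_singleton (μ : Measure ℝ) (k : ℕ) : mixedPoi μ {k} = ∫⁻ x, poi x {k} ∂μ := by
  rw [mixedPoi, Measure.sum_smul_dirac_singleton]

lemma mixedPoi_dirac (x : ℝ) : mixedPoi (Measure.dirac x) = poi x := by
  refine Measure.ext_of_singleton fun k => ?_
  rw [mixedPoi_singleton, lintegral_dirac' _ (measurable_poi_singleton k)]

lemma downshiftedSizeBias_singleton (p : Measure ℕ) (k : ℕ) :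
    downshiftedSizeBias p {k} = ((k + 1 : ℕ) : ℝ≥0∞) * p {k + 1} / mean p := by
  rw [downshiftedSizeBias, Measure.sum_smul_dirac_singleton, sizeBias,
    Measure.sum_smul_dirac_singleton]

variable {Ω : Type*} [MeasurableSpace Ω] {ν : Measure Ω} {X w : Ω → ℝ}

lemma mixedPoi_map_singleton (hX : Measurable X) (hX0 : ∀ ω, 0 ≤ X ω) (k : ℕ) :
    mixedPoi (ν.map X) {k} =
      ∫⁻ ω, ENNReal.ofReal (Real.exp (-X ω) * X ω ^ k / (k.factorial : ℝ)) ∂ν := by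
  rw [mixedPoi_singleton, lintegral_map (measurable_poi_singleton k) hX]
  exact lintegral_congr fun ω => poi_singleton (hX0 ω) k

lemma hasSum_poisson_weights (x s : ℝ) :
    HasSum (fun k : ℕ => s ^ k * (Real.exp (-x) * x ^ k / (k.factorial : ℝ)))
      (Real.exp (-(x * (1 - s)))) := by
  have h := (NormedSpace.expSeries_div_hasSum_exp (s * x)).mul_left (Real.exp (-x))
  rw [← Real.exp_eq_exp_ℝ, ← Real.exp_add] at h
  rw [show -(x * (1 - s)) = -x + s * x by ring]
  refine Eq.mp (congrArg (HasSum · _) (funext fun k => ?_)) h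
  rw [mul_pow]; ring

/-- Weighted mixtures of Poisson mass functions: summing the masses against `s ^ k` gives the
weighted Laplace transform. -/
lemma tsum_pow_mul_lintegral (hX : Measurable X) (hX0 : ∀ ω, 0 ≤ X ω) (hw : Integrable w ν)
    (hwm : Measurable w) (hw0 : ∀ ω, 0 ≤ w ω) {s : ℝ} (hs0 : 0 ≤ s) (hs1 : s ≤ 1) :
    ∑' k : ℕ, ENNReal.ofReal (s ^ k) * ∫⁻ ω, ENNReal.ofReal
        (w ω * (Real.exp (-X ω) * X ω ^ k / (k.factorial : ℝ))) ∂ν =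
      ENNReal.ofReal (∫ ω, w ω * Real.exp (-(X ω * (1 - s))) ∂ν) := by
  have hint : Integrable (fun ω => w ω * Real.exp (-(X ω * (1 - s)))) ν := by
    refine hw.mono (by fun_prop) (.of_forall fun ω => ?_)
    rw [Real.norm_of_nonneg (mul_nonneg (hw0 ω) (Real.exp_pos _).le),
      Real.norm_of_nonneg (hw0 ω)]
    refine mul_le_of_le_one_right (hw0 ω) (Real.exp_le_one_iff.2 ?_)
    nlinarith [hX0 ω]
  rw [ofReal_integral_eq_lintegral_ofReal hint
    (.of_forall fun ω => mul_nonneg (hw0 ω) (Real.exp_pos _).le)]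
  have h1 : ∀ k : ℕ, ENNReal.ofReal (s ^ k) * ∫⁻ ω, ENNReal.ofReal
        (w ω * (Real.exp (-X ω) * X ω ^ k / (k.factorial : ℝ))) ∂ν =
      ∫⁻ ω, ENNReal.ofReal
        (w ω * (s ^ k * (Real.exp (-X ω) * X ω ^ k / (k.factorial : ℝ)))) ∂ν := by
    intro k
    rw [← lintegral_const_mul _ (by fun_prop)]
    refine lintegral_congr fun ω => ?_
    rw [← ENNReal.ofReal_mul (by positivity)]
    congr 1; ring
  simp_rw [h1]
  rw [← lintegral_tsum (fun k => by fun_prop)]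
  refine lintegral_congr fun ω => ?_
  have h2 := (hasSum_poisson_weights (X ω) s).mul_left (w ω)
  rw [← ENNReal.ofReal_tsum_of_nonneg _ h2.summable, h2.tsum_eq]
  intro k
  have := hX0 ω
  have := hw0 ω
  positivity

/-- The generating function of a measure whose masses are weighted mixed Poisson masses. -/
lemma genFun_of_singleton {p : Measure ℕ} (hX : Measurable X) (hX0 : ∀ ω, 0 ≤ X ω)
    (hw : Integrable w ν) (hwm : Measurable w) (hw0 : ∀ ω, 0 ≤ w ω)
    (hp : ∀ k : ℕ, p {k} = ∫⁻ ω, ENNReal.ofReal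
        (w ω * (Real.exp (-X ω) * X ω ^ k / (k.factorial : ℝ))) ∂ν)
    {s : ℝ} (hs0 : 0 ≤ s) (hs1 : s ≤ 1) :
    genFun p s = ∫ ω, w ω * Real.exp (-(X ω * (1 - s))) ∂ν := by
  have h := tsum_pow_mul_lintegral hX hX0 hw hwm hw0 hs0 hs1
  have hne : ∀ k : ℕ, ENNReal.ofReal (s ^ k) * p {k} ≠ ∞ := by
    refine ENNReal.ne_top_of_tsum_ne_top ?_
    simp_rw [hp, h]
    exact ENNReal.ofReal_ne_top
  have h3 : genFun p s = (∑' k : ℕ, ENNReal.ofReal (s ^ k) * p {k}).toReal := by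
    rw [ENNReal.tsum_toReal_eq hne, genFun]
    refine tsum_congr fun k => ?_
    rw [ENNReal.toReal_mul, ENNReal.toReal_ofReal (by positivity), measureReal_def]
  simp_rw [h3, hp, h]
  exact ENNReal.toReal_ofReal (integral_nonneg fun ω => mul_nonneg (hw0 ω) (Real.exp_pos _).le)

lemma genFun_mixedPoi_map [IsProbabilityMeasure ν] (hX : Measurable X) (hX0 : ∀ ω, 0 ≤ X ω)
    {s : ℝ} (hs0 : 0 ≤ s) (hs1 : s ≤ 1) :
    genFun (mixedPoi (ν.map X)) s = ∫ ω, Real.exp (-(X ω * (1 - s))) ∂ν := by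
  simpa using genFun_of_singleton (w := fun _ => 1) (p := mixedPoi (ν.map X)) hX hX0
    (integrable_const 1) measurable_const (fun _ => zero_le_one)
    (fun k => by simpa using mixedPoi_map_singleton hX hX0 k) hs0 hs1

/-- The factor `k + 1` cancels against the factorial and frees one factor `X`: size biasing followed
by the downshift just weights the mixing law by `X`. -/
lemma succ_mul_mixedPoi_map_singleton (hX : Measurable X) (hX0 : ∀ ω, 0 ≤ X ω) (k : ℕ) :
    ((k + 1 : ℕ) : ℝ≥0∞) * mixedPoi (ν.map X) {k + 1} =
      ∫⁻ ω, ENNReal.ofReal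
        (X ω * (Real.exp (-X ω) * X ω ^ k / (k.factorial : ℝ))) ∂ν := by
  rw [mixedPoi_map_singleton hX hX0, ← lintegral_const_mul _ (by fun_prop)]
  refine lintegral_congr fun ω => ?_
  rw [← ENNReal.ofReal_natCast, ← ENNReal.ofReal_mul (by positivity), Nat.factorial_succ]
  congr 1
  push_cast
  rw [pow_succ]
  field_simp

lemma mean_mixedPoi_map (hX : Measurable X) (hX0 : ∀ ω, 0 ≤ X ω) (hXi : Integrable X ν) :
    mean (mixedPoi (ν.map X)) = ENNReal.ofReal (∫ ω, X ω ∂ν) := by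
  have h := tsum_pow_mul_lintegral hX hX0 hXi hX hX0 zero_le_one le_rfl
  simp only [one_pow, ENNReal.ofReal_one, one_mul, sub_self, mul_zero, neg_zero, Real.exp_zero,
    mul_one] at h
  rw [← h, mean, tsum_eq_zero_add' ENNReal.summable]
  simp only [Nat.cast_zero, zero_mul, zero_add]
  exact tsum_congr fun k => succ_mul_mixedPoi_map_singleton hX hX0 k

lemma genFun_downshiftedSizeBias_mixedPoi_map (hX : Measurable X) (hX0 : ∀ ω, 0 ≤ X ω)
    (hXi : Integrable X ν) {m : ℝ} (hm : 0 < m) (hXm : ∫ ω, X ω ∂ν = m)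
    {s : ℝ} (hs0 : 0 ≤ s) (hs1 : s ≤ 1) :
    genFun (downshiftedSizeBias (mixedPoi (ν.map X))) s =
      (∫ ω, X ω * Real.exp (-(X ω * (1 - s))) ∂ν) / m := by
  rw [genFun_of_singleton (w := fun ω => X ω / m) hX hX0 (hXi.div_const m) (by fun_prop)
    (fun ω => div_nonneg (hX0 ω) hm.le) ?_ hs0 hs1, ← integral_div]
  · exact integral_congr_ae (.of_forall fun ω => by ring)
  · intro k
    rw [downshiftedSizeBias_singleton, mean_mixedPoi_map hX hX0 hXi, hXm,
      succ_mul_mixedPoi_map_singleton hX hX0, ENNReal.div_eq_inv_mul,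
      ← ENNReal.ofReal_inv_of_pos hm, ← lintegral_const_mul _ (by fun_prop)]
    refine lintegral_congr fun ω => ?_
    rw [← ENNReal.ofReal_mul (by positivity)]
    congr 1; ring

/-! ### Fixed points of continuous functions on the unit interval -/

lemma continuousOn_integral_mul_exp (hX : Measurable X) (hX0 : ∀ ω, 0 ≤ X ω)
    (hw : Integrable w ν) :
    ContinuousOn (fun s : ℝ => ∫ ω, w ω * Real.exp (-(X ω * (1 - s))) ∂ν) (Set.Icc 0 1) := by
  refine continuousOn_of_dominated (bound := fun ω => ‖w ω‖)
    (fun s _ => hw.aestronglyMeasurable.mul (by fun_prop)) (fun s hs => .of_forall fun ω => ?_)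
    hw.norm (.of_forall fun ω => by fun_prop)
  rw [norm_mul, Real.norm_of_nonneg (Real.exp_pos _).le]
  refine mul_le_of_le_one_right (norm_nonneg _) (Real.exp_le_one_iff.2 ?_)
  nlinarith [hX0 ω, hs.2]

lemma extinctionProb_le {p : Measure ℕ} {s : ℝ} (hs : s ∈ Set.Icc (0 : ℝ) 1)
    (h : genFun p s = s) : extinctionProb p ≤ s :=
  csInf_le ⟨0, fun _ hx => hx.1.1⟩ ⟨hs, h⟩

lemma genFun_nonneg (p : Measure ℕ) {s : ℝ} (hs : 0 ≤ s) : 0 ≤ genFun p s :=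
  tsum_nonneg fun _ => mul_nonneg (pow_nonneg hs _) measureReal_nonneg

/-- If `G_p(s) ≤ s` then `η(p)` is a fixed point of `G_p` and is at most `s`. -/
lemma extinctionProb_spec {p : Measure ℕ} (hc : ContinuousOn (genFun p) (Set.Icc 0 1))
    {s : ℝ} (hs : s ∈ Set.Icc (0 : ℝ) 1) (h : genFun p s ≤ s) :
    0 ≤ extinctionProb p ∧ extinctionProb p ≤ s ∧
      genFun p (extinctionProb p) = extinctionProb p := by
  have hsub : Set.Icc (0 : ℝ) s ⊆ Set.Icc 0 1 := Set.Icc_subset_Icc_right hs.2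
  -- `G_p(s) - s` is nonnegative at `0` and nonpositive at `s`, so a fixed point lies between;
  -- closedness of the fixed-point set then makes the infimum one.
  obtain ⟨x, hx, hx0⟩ : ∃ x ∈ Set.Icc (0 : ℝ) s, genFun p x - x = 0 := by
    have := intermediate_value_Icc' hs.1 ((hc.mono hsub).sub continuousOn_id)
    exact this ⟨sub_nonpos.2 h, by simpa using genFun_nonneg p le_rfl⟩
  have hxfix : genFun p x = x := sub_eq_zero.1 hx0
  have hclosed : IsClosed {s : ℝ | s ∈ Set.Icc (0 : ℝ) 1 ∧ genFun p s = s} := by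
    have := (hc.sub continuousOn_id).preimage_isClosed_of_isClosed isClosed_Icc
      (isClosed_singleton (x := (0 : ℝ)))
    convert this using 1
    ext y
    simp [sub_eq_zero]
  have hmem := hclosed.csInf_mem ⟨x, hsub hx, hxfix⟩ ⟨0, fun _ hx => hx.1.1⟩
  exact ⟨hmem.1.1, (extinctionProb_le (hsub hx) hxfix).trans hx.2, hmem.2⟩

/-! ### The critical value -/

lemma genFun_poi {x : ℝ} (hx : 0 ≤ x) (s : ℝ) : genFun (poi x) s = Real.exp (-(x * (1 - s))) := by
  rw [genFun, ← (hasSum_poisson_weights x s).tsum_eq]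
  refine tsum_congr fun k => ?_
  rw [measureReal_def, poi_singleton hx, ENNReal.toReal_ofReal (by positivity)]

lemma continuous_genFun_poi {x : ℝ} (hx : 0 ≤ x) : Continuous (genFun (poi x)) := by
  rw [funext (genFun_poi hx)]
  fun_prop

/-- This makes the set defining `lambdaCr` nonempty; otherwise its `sInf` would default to `0`. A
smaller fixed point, together with `e⁻²` and `1`, would give three fixed points of a strictly convex
function. -/
lemma extinctionProb_poi_critical :
    extinctionProb (poi (2 / (1 - Real.exp (-2)))) = Real.exp (-2) := by
  have he : Real.exp (-2) < 1 := Real.exp_lt_one_iff.2 (by norm_num)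
  have hpos : 0 < 1 - Real.exp (-2) := sub_pos.2 he
  set x := 2 / (1 - Real.exp (-2)) with hxdef
  have hx : 0 < x := by positivity
  have hfix : genFun (poi x) (Real.exp (-2)) = Real.exp (-2) := by
    rw [genFun_poi hx.le, hxdef, div_mul_cancel₀ _ hpos.ne']
  obtain ⟨h0, h1, h2⟩ := extinctionProb_spec (continuous_genFun_poi hx.le).continuousOn
    ⟨(Real.exp_pos _).le, he.le⟩ hfix.le
  refine h1.antisymm (not_lt.1 fun hlt => ?_)
  set y := extinctionProb (poi x)
  rw [genFun_poi hx.le] at h2 hfix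
  -- Both chords of `exp` between consecutive fixed points have slope `1/x`, against strict
  -- convexity.
  have key := strictConvexOn_exp.slope_strict_mono_adjacent (x := -(x * (1 - y)))
    (y := -(x * (1 - Real.exp (-2)))) (z := 0) (Set.mem_univ _) (Set.mem_univ _) (by nlinarith)
    (by nlinarith)
  rw [h2, hfix, Real.exp_zero,
    show -(x * (1 - Real.exp (-2))) - -(x * (1 - y)) = x * (Real.exp (-2) - y) by ring,
    show 0 - -(x * (1 - Real.exp (-2))) = x * (1 - Real.exp (-2)) by ring,
    div_mul_cancel_right₀ (sub_pos.2 hlt).ne', div_mul_cancel_right₀ hpos.ne'] at key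
  exact lt_irrefl _ key

/-- The critical value is at least `2 / (1 - e⁻²)`. -/
lemma le_lambdaCr : 2 / (1 - Real.exp (-2)) ≤ lambdaCr := by
  have hpos : 0 < 1 - Real.exp (-2) := sub_pos.2 (Real.exp_lt_one_iff.2 (by norm_num))
  refine le_csInf ⟨2 / (1 - Real.exp (-2)), by positivity, ?_⟩ ?_
  · rw [survivalProb, extinctionProb_poi_critical, div_mul_cancel₀ _ hpos.ne']
  · rintro x ⟨hx, h⟩
    -- The fixed point `s = 1` always exists, so `η = e^{-xζ}`; with `xζ = 2` this forces `ζ = 1 -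
    -- e⁻²` and determines `x`.
    obtain ⟨-, -, h2⟩ := extinctionProb_spec (continuous_genFun_poi hx).continuousOn
      (Set.right_mem_Icc.2 zero_le_one) (by simp [genFun_poi hx])
    rw [genFun_poi hx, ← survivalProb, h] at h2
    rw [survivalProb, ← h2] at h
    rw [div_le_iff₀ hpos, h]

/-! ### The Pareto family as a function of one exponential variable -/

lemma expMeasure_one_eq : expMeasure 1 =
    (volume.restrict (Set.Ici (0 : ℝ))).withDensity fun t => ENNReal.ofReal (Real.exp (-t)) := by
  rw [← withDensity_indicator measurableSet_Ici]
  change volume.withDensity (exponentialPDF 1) = _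
  congr 1
  ext t
  rw [exponentialPDF_eq, Set.indicator_apply]
  by_cases h : 0 ≤ t <;> simp [h]

lemma ae_nonneg_expMeasure_one : ∀ᵐ t ∂(expMeasure 1), 0 ≤ t := by
  rw [expMeasure_one_eq]
  exact (withDensity_absolutelyContinuous _ _).ae_le (ae_restrict_mem measurableSet_Ici)

instance isProbabilityMeasure_expMeasure_one : IsProbabilityMeasure (expMeasure 1) :=
  isProbabilityMeasure_expMeasure one_pos

/-- The random variable `lam (1 - ε) e^{ε t}`; for `t` standard exponential it has the Pareto
distribution of shape `1 / ε` and mean `lam`. -/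
noncomputable def expPareto (lam ε t : ℝ) : ℝ := lam * (1 - ε) * Real.exp (ε * t)

lemma measurable_expPareto (lam ε : ℝ) : Measurable (expPareto lam ε) := by
  unfold expPareto; fun_prop

lemma expPareto_nonneg {lam ε : ℝ} (hlam : 0 ≤ lam) (hε : ε ≤ 1) (t : ℝ) :
    0 ≤ expPareto lam ε t :=
  mul_nonneg (mul_nonneg hlam (sub_nonneg.2 hε)) (Real.exp_pos _).le

lemma le_expPareto {lam ε t : ℝ} (hlam : 0 ≤ lam) (hε0 : 0 ≤ ε) (hε : ε ≤ 1) (ht : 0 ≤ t) :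
    lam * (1 - ε) ≤ expPareto lam ε t :=
  le_mul_of_one_le_right (mul_nonneg hlam (sub_nonneg.2 hε))
    (Real.one_le_exp (mul_nonneg hε0 ht))

lemma integrable_expPareto (lam : ℝ) {ε : ℝ} (hε : ε < 1) :
    Integrable (expPareto lam ε) (expMeasure 1) ∧
      ∫ t, expPareto lam ε t ∂(expMeasure 1) = lam := by
  have hcongr : ∀ t : ℝ, (ENNReal.ofReal (Real.exp (-t))).toReal • expPareto lam ε t =
      lam * (1 - ε) * Real.exp ((ε - 1) * t) := by
    intro t
    rw [ENNReal.toReal_ofReal (Real.exp_pos _).le, smul_eq_mul, expPareto, mul_left_comm,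
      ← Real.exp_add]
    congr 2; ring
  have hm : Measurable fun t : ℝ => ENNReal.ofReal (Real.exp (-t)) := by fun_prop
  rw [expMeasure_one_eq]
  constructor
  · rw [integrable_withDensity_iff_integrable_smul' hm (.of_forall fun _ => ENNReal.ofReal_lt_top)]
    simp_rw [hcongr]
    exact (integrableOn_Ici_iff_integrableOn_Ioi (by simp) |>.2
      (integrableOn_exp_mul_Ioi (by linarith) 0)).const_mul _
  · rw [integral_withDensity_eq_integral_toReal_smul hm
      (.of_forall fun _ => ENNReal.ofReal_lt_top)]
    simp_rw [hcongr]
    rw [integral_const_mul, integral_Ici_eq_integral_Ioi, integral_exp_mul_Ioi (by linarith)]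
    have : ε - 1 ≠ 0 := by linarith
    simp
    field_simp
    ring

lemma map_expPareto_zero (lam : ℝ) :
    (expMeasure 1).map (expPareto lam 0) = Measure.dirac lam := by
  have : expPareto lam 0 = fun _ => lam := by ext t; simp [expPareto]
  rw [this, Measure.map_const, measure_univ, one_smul]

/-- Change of variables along `t ↦ c e^{t/α}`, an increasing bijection from `[0, ∞)` onto `[c, ∞)`,
outside which the Pareto density vanishes. -/
lemma map_expPareto_eq_paretoMeasure {lam α : ℝ} (hlam : 0 < lam) (hα : 1 < α) :
    (expMeasure 1).map (expPareto lam (1 / α)) = paretoMeasure (lam * (1 - 1 / α)) α := by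
  have hα0 : 0 < α := by linarith
  set c := lam * (1 - 1 / α) with hc
  have hc0 : 0 < c := mul_pos hlam (sub_pos.2 ((div_lt_one hα0).2 hα))
  set f := expPareto lam (1 / α) with hf
  have hfe : ∀ t, f t = c * Real.exp (1 / α * t) := fun t => rfl
  have hderiv : ∀ t, HasDerivAt f (1 / α * f t) t := by
    intro t
    refine ((((hasDerivAt_id t).const_mul (1 / α)).exp).const_mul c).congr_deriv ?_
    rw [hfe]; simp only [id_eq]; ring
  have hpos : ∀ t, 0 < f t := fun t => mul_pos hc0 (Real.exp_pos _)
  have hmono : StrictMono f := by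
    intro a b hab
    rw [hfe, hfe]
    gcongr
  have himage : f '' Set.Ici 0 = Set.Ici c := by
    ext x
    constructor
    · rintro ⟨t, ht, rfl⟩
      have := hmono.monotone (Set.mem_Ici.1 ht)
      simpa [hfe] using this
    · intro hx
      have hx0 : 0 < x := hc0.trans_le hx
      refine ⟨α * Real.log (x / c), mul_nonneg hα0.le (Real.log_nonneg ((one_le_div hc0).2 hx)), ?_⟩
      rw [hfe, ← mul_assoc, one_div_mul_cancel hα0.ne', one_mul, Real.exp_log (by positivity)]
      field_simp
  refine Measure.ext_of_lintegral _ fun g hg => ?_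
  rw [lintegral_map hg (measurable_expPareto _ _), expMeasure_one_eq,
    lintegral_withDensity_eq_lintegral_mul _ (by fun_prop)
      (show Measurable fun t => g (expPareto lam (1 / α) t) from
        hg.comp (measurable_expPareto _ _)), paretoMeasure,
    lintegral_withDensity_eq_lintegral_mul _
      (show Measurable (paretoPDF c α) from (measurable_paretoPDFReal c α).ennreal_ofReal) hg]
  have hrest : ∫⁻ x, (paretoPDF c α * g) x = ∫⁻ x in Set.Ici c, (paretoPDF c α * g) x := by
    rw [← lintegral_indicator measurableSet_Ici]
    refine lintegral_congr fun x => ?_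
    by_cases hx : c ≤ x
    · simp [hx]
    · simp [hx, paretoPDF_of_lt (not_le.1 hx)]
  rw [hrest, ← himage, lintegral_image_eq_lintegral_abs_deriv_mul measurableSet_Ici
    (fun t _ => (hderiv t).hasDerivWithinAt) hmono.injective.injOn]
  refine setLIntegral_congr_fun measurableSet_Ici fun t ht => ?_
  have hct : c ≤ f t := by
    have := Set.mem_image_of_mem f ht
    rwa [himage] at this
  simp only [Pi.mul_apply]
  rw [← mul_assoc, paretoPDF_of_le hct, abs_of_pos (mul_pos (one_div_pos.2 hα0) (hpos t)),
    ← ENNReal.ofReal_mul (mul_pos (one_div_pos.2 hα0) (hpos t)).le]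
  congr 2
  have h1 : f t ^ (-(α + 1)) = c ^ (-α) * c⁻¹ * (Real.exp (-t) * (Real.exp (1 / α * t))⁻¹) := by
    rw [hfe, Real.mul_rpow hc0.le (Real.exp_pos _).le, ← Real.exp_mul, ← Real.exp_neg,
      ← Real.exp_add, neg_add, Real.rpow_add hc0, Real.rpow_neg_one]
    congr 2
    field_simp
  rw [h1, Real.rpow_neg hc0.le, hfe]
  have := Real.rpow_pos_of_pos hc0 α
  field_simp

/-! ### Convex ordering -/

/-- Replacing the slope at `y` by the slope at a point `y₀` with `y` between `y₀` and `y'` keeps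
the tangent line inequality. -/
lemma _root_.ConvexOn.add_mul_sub_le {S : Set ℝ} {f : ℝ → ℝ} (hf : ConvexOn ℝ S f)
    (hd : Differentiable ℝ f) {y₀ y y' : ℝ} (h₀ : y₀ ∈ S) (hy : y ∈ S) (hy' : y' ∈ S)
    (h : (y₀ ≤ y ∧ y ≤ y') ∨ (y' ≤ y ∧ y ≤ y₀)) :
    f y + deriv f y₀ * (y' - y) ≤ f y' := by
  rcases h with ⟨h1, h2⟩ | ⟨h1, h2⟩
  · rcases h2.eq_or_lt with rfl | h2
    · simp
    have hs : deriv f y₀ ≤ slope f y y' := by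
      refine le_trans ?_ (hf.deriv_le_slope hy hy' h2 (hd y))
      rcases h1.eq_or_lt with rfl | h1
      · exact le_rfl
      · exact (hf.deriv_le_slope h₀ hy h1 (hd _)).trans (hf.slope_le_deriv h₀ hy h1 (hd _))
    rw [slope_def_field, le_div_iff₀ (sub_pos.2 h2)] at hs
    linarith
  · rcases h1.eq_or_lt with rfl | h1
    · simp
    have hs : slope f y' y ≤ deriv f y₀ := by
      refine le_trans (hf.slope_le_deriv hy' hy h1 (hd y)) ?_
      rcases h2.eq_or_lt with rfl | h2
      · exact le_rfl
      · exact (hf.deriv_le_slope hy h₀ h2 (hd _)).trans (hf.slope_le_deriv hy h₀ h2 (hd _))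
    rw [slope_def_field, div_le_iff₀ (sub_pos.2 h1)] at hs
    linarith

/-- The variables `expPareto lam ε` increase in the convex order with `ε`. -/
lemma integral_comp_expPareto_mono {lam ε ε' : ℝ} (hlam : 0 < lam) (hε : 0 ≤ ε) (hεε' : ε ≤ ε')
    (hε' : ε' < 1) {f : ℝ → ℝ} (hf : ConvexOn ℝ (Set.Ici (lam * (1 - ε'))) f)
    (hd : Differentiable ℝ f)
    (hi : Integrable (fun t => f (expPareto lam ε t)) (expMeasure 1))
    (hi' : Integrable (fun t => f (expPareto lam ε' t)) (expMeasure 1)) :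
    ∫ t, f (expPareto lam ε t) ∂(expMeasure 1) ≤ ∫ t, f (expPareto lam ε' t) ∂(expMeasure 1) := by
  rcases hεε'.eq_or_lt with rfl | hlt
  · exact le_rfl
  have h1 : 0 < 1 - ε' := by linarith
  have h2 : 0 < 1 - ε := by linarith
  -- the point where the two curves cross
  set t₀ := Real.log ((1 - ε) / (1 - ε')) / (ε' - ε) with ht₀
  have ht₀0 : 0 ≤ t₀ :=
    div_nonneg (Real.log_nonneg ((one_le_div h1).2 (by linarith))) (by linarith)
  have hcross : 1 - ε = (1 - ε') * Real.exp ((ε' - ε) * t₀) := by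
    rw [ht₀, mul_div_cancel₀ _ (by linarith : ε' - ε ≠ 0), Real.exp_log (by positivity)]
    field_simp
  have hexp : ∀ t, expPareto lam ε t =
      lam * (1 - ε') * Real.exp (ε * t + (ε' - ε) * t₀) := by
    intro t
    rw [expPareto, hcross, Real.exp_add]
    ring
  have hexp' : ∀ t, expPareto lam ε' t =
      lam * (1 - ε') * Real.exp (ε * t + (ε' - ε) * t) := by
    intro t
    rw [expPareto]
    congr 2; ring
  have hmemS : ∀ t, 0 ≤ t → expPareto lam ε t ∈ Set.Ici (lam * (1 - ε')) := fun t ht =>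
    le_trans (by gcongr) (le_expPareto hlam.le hε (by linarith) ht)
  set y₀ := expPareto lam ε t₀ with hy₀
  set k := deriv f y₀
  have hX := integrable_expPareto lam (ε := ε) (by linarith)
  have hX' := integrable_expPareto lam hε'
  -- The slope `k` is fixed at the crossing value `y₀`. For each `t ≥ 0`, `expPareto lam ε t` lies
  -- between `y₀` and `expPareto lam ε' t`, and the linear term integrates to zero because the means
  -- agree.
  have hle : ∫ t, (f (expPareto lam ε t) + k * (expPareto lam ε' t - expPareto lam ε t))
      ∂(expMeasure 1) ≤ ∫ t, f (expPareto lam ε' t) ∂(expMeasure 1) := by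
    refine integral_mono_ae (hi.add ((hX'.1.sub hX.1).const_mul k)) hi' ?_
    filter_upwards [ae_nonneg_expMeasure_one] with t ht
    refine hf.add_mul_sub_le hd (hmemS _ ht₀0) (hmemS t ht)
      (le_expPareto hlam.le (by linarith) hε'.le ht) ?_
    have hmul : 0 ≤ lam * (1 - ε') := by positivity
    have hdiff : 0 ≤ ε' - ε := by linarith
    rcases le_total t₀ t with h | h
    · left
      rw [hy₀, hexp, hexp, hexp']
      constructor <;> gcongr
    · right
      rw [hy₀, hexp, hexp, hexp']
      constructor <;> gcongr
  have hdiff : Integrable (fun t => expPareto lam ε' t - expPareto lam ε t) (expMeasure 1) :=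
    hX'.1.sub hX.1
  rw [integral_add hi (hdiff.const_mul k), integral_const_mul,
    integral_sub hX'.1 hX.1, hX'.2, hX.2] at hle
  simpa using hle

lemma convexOn_exp_neg_mul (u : ℝ) : ConvexOn ℝ Set.univ fun x => Real.exp (-(x * u)) := by
  have := convexOn_exp.comp_linearMap ((-u) • LinearMap.id : ℝ →ₗ[ℝ] ℝ)
  refine this.congr fun x _ => ?_
  simp [mul_comm]

/-- The second derivative is `u (xu - 2) e^{-xu}`; this is the origin of the constant `2` in
`lambdaCr`. -/
lemma convexOn_mul_exp_neg_mul {u b : ℝ} (hu : 0 ≤ u) (hb : 2 ≤ b * u) :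
    ConvexOn ℝ (Set.Ici b) fun x => x * Real.exp (-(x * u)) := by
  have hE : ∀ x : ℝ, HasDerivAt (fun x => Real.exp (-(x * u))) (Real.exp (-(x * u)) * -u) x := by
    intro x
    simpa using ((hasDerivAt_id x).mul_const u).neg.exp
  refine convexOn_of_hasDerivWithinAt2_nonneg (convex_Ici b) (by fun_prop)
    (f' := fun x => (1 - x * u) * Real.exp (-(x * u)))
    (f'' := fun x => u * (x * u - 2) * Real.exp (-(x * u)))
    (fun x _ => HasDerivAt.hasDerivWithinAt ?_) (fun x _ => HasDerivAt.hasDerivWithinAt ?_) ?_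
  · refine ((hasDerivAt_id x).mul (hE x)).congr_deriv ?_
    simp only [id_eq]; ring
  · refine ((((hasDerivAt_id x).mul_const u).const_sub 1).mul (hE x)).congr_deriv ?_
    simp only [id_eq]; ring
  · intro x hx
    rw [interior_Ici, Set.mem_Ioi] at hx
    have : 2 ≤ x * u := hb.trans (by gcongr)
    have : 0 ≤ x * u - 2 := by linarith
    positivity

/-! ### Comparison along the Pareto family -/

/-- The mixed Poisson distribution driven by `expPareto lam ε`. -/
noncomputable def expParetoMixedPoi (lam ε : ℝ) : Measure ℕ :=
  mixedPoi ((expMeasure 1).map (expPareto lam ε))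

lemma expParetoMixedPoi_zero (lam : ℝ) : expParetoMixedPoi lam 0 = poi lam := by
  rw [expParetoMixedPoi, map_expPareto_zero, mixedPoi_dirac]

lemma expParetoMixedPoi_one_div {lam α : ℝ} (hlam : 0 < lam) (hα : 1 < α) :
    expParetoMixedPoi lam (1 / α) = paretoMixedPoi lam α := by
  rw [expParetoMixedPoi, map_expPareto_eq_paretoMeasure hlam hα, paretoMixedPoi]

lemma integrable_expPareto_mul_exp {lam ε u : ℝ} (hlam : 0 < lam) (hε : ε < 1) (hu : 0 ≤ u) :
    Integrable (fun t => expPareto lam ε t * Real.exp (-(expPareto lam ε t * u)))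
      (expMeasure 1) := by
  have hm := measurable_expPareto lam ε
  refine (integrable_expPareto lam hε).1.mono (by fun_prop) (.of_forall fun t => ?_)
  rw [norm_mul, Real.norm_of_nonneg (Real.exp_pos _).le]
  refine mul_le_of_le_one_right (norm_nonneg _) (Real.exp_le_one_iff.2 ?_)
  exact neg_nonpos.2 (mul_nonneg (expPareto_nonneg hlam.le hε.le t) hu)

lemma integrable_exp_expPareto {lam ε u : ℝ} (hlam : 0 < lam) (hε : ε < 1) (hu : 0 ≤ u) :
    Integrable (fun t => Real.exp (-(expPareto lam ε t * u))) (expMeasure 1) := by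
  have hm := measurable_expPareto lam ε
  refine (integrable_const (1 : ℝ)).mono (by fun_prop) (.of_forall fun t => ?_)
  rw [Real.norm_of_nonneg (Real.exp_pos _).le, norm_one]
  exact Real.exp_le_one_iff.2
    (neg_nonpos.2 (mul_nonneg (expPareto_nonneg hlam.le hε.le t) hu))

lemma genFun_expParetoMixedPoi {lam ε s : ℝ} (hlam : 0 < lam) (hε : ε < 1) (hs0 : 0 ≤ s)
    (hs1 : s ≤ 1) : genFun (expParetoMixedPoi lam ε) s =
      ∫ t, Real.exp (-(expPareto lam ε t * (1 - s))) ∂(expMeasure 1) :=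
  genFun_mixedPoi_map (measurable_expPareto _ _) (expPareto_nonneg hlam.le hε.le) hs0 hs1

lemma genFun_downshiftedSizeBias_expParetoMixedPoi {lam ε s : ℝ} (hlam : 0 < lam) (hε : ε < 1)
    (hs0 : 0 ≤ s) (hs1 : s ≤ 1) :
    genFun (downshiftedSizeBias (expParetoMixedPoi lam ε)) s =
      (∫ t, expPareto lam ε t * Real.exp (-(expPareto lam ε t * (1 - s))) ∂(expMeasure 1)) / lam :=
  genFun_downshiftedSizeBias_mixedPoi_map (measurable_expPareto _ _)
    (expPareto_nonneg hlam.le hε.le) (integrable_expPareto lam hε).1 hlam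
    (integrable_expPareto lam hε).2 hs0 hs1

lemma continuousOn_genFun_downshiftedSizeBias {lam ε : ℝ} (hlam : 0 < lam) (hε : ε < 1) :
    ContinuousOn (genFun (downshiftedSizeBias (expParetoMixedPoi lam ε))) (Set.Icc 0 1) :=
  ((continuousOn_integral_mul_exp (measurable_expPareto _ _) (expPareto_nonneg hlam.le hε.le)
    (integrable_expPareto lam hε).1).div_const lam).congr fun _ hs =>
      genFun_downshiftedSizeBias_expParetoMixedPoi hlam hε hs.1 hs.2

/-- On the range where `x ↦ x e^{-(1-s)x}` is convex on the support, the generating function of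
the downshifted size biasing increases with `ε`. -/
lemma genFun_downshiftedSizeBias_mono {lam ε ε' s : ℝ} (hlam : 0 < lam) (hε : 0 ≤ ε)
    (hεε' : ε ≤ ε') (hε' : ε' < 1) (hs0 : 0 ≤ s) (hs1 : s ≤ 1)
    (hs : 2 ≤ lam * (1 - ε') * (1 - s)) :
    genFun (downshiftedSizeBias (expParetoMixedPoi lam ε)) s ≤
      genFun (downshiftedSizeBias (expParetoMixedPoi lam ε')) s := by
  have hu : 0 ≤ 1 - s := sub_nonneg.2 hs1
  rw [genFun_downshiftedSizeBias_expParetoMixedPoi hlam (hεε'.trans_lt hε') hs0 hs1,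
    genFun_downshiftedSizeBias_expParetoMixedPoi hlam hε' hs0 hs1]
  refine div_le_div_of_nonneg_right ?_ hlam.le
  exact integral_comp_expPareto_mono hlam hε hεε' hε' (convexOn_mul_exp_neg_mul hu hs)
    (by fun_prop) (integrable_expPareto_mul_exp hlam (hεε'.trans_lt hε') hu)
    (integrable_expPareto_mul_exp hlam hε' hu)

lemma genFun_expParetoMixedPoi_mono {lam ε ε' s : ℝ} (hlam : 0 < lam) (hε : 0 ≤ ε)
    (hεε' : ε ≤ ε') (hε' : ε' < 1) (hs0 : 0 ≤ s) (hs1 : s ≤ 1) :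
    genFun (expParetoMixedPoi lam ε) s ≤ genFun (expParetoMixedPoi lam ε') s := by
  have hu : 0 ≤ 1 - s := sub_nonneg.2 hs1
  rw [genFun_expParetoMixedPoi hlam (hεε'.trans_lt hε') hs0 hs1,
    genFun_expParetoMixedPoi hlam hε' hs0 hs1]
  exact integral_comp_expPareto_mono hlam hε hεε' hε'
    (f := fun x => Real.exp (-(x * (1 - s))))
    ((convexOn_exp_neg_mul _).subset (Set.subset_univ _) (convex_Ici _)) (by fun_prop)
    (integrable_exp_expPareto hlam (hεε'.trans_lt hε') hu) (integrable_exp_expPareto hlam hε' hu)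

lemma genFun_expParetoMixedPoi_monotone {lam ε s s' : ℝ} (hlam : 0 < lam) (hε : ε < 1)
    (hs0 : 0 ≤ s) (hss' : s ≤ s') (hs' : s' ≤ 1) :
    genFun (expParetoMixedPoi lam ε) s ≤ genFun (expParetoMixedPoi lam ε) s' := by
  rw [genFun_expParetoMixedPoi hlam hε hs0 (hss'.trans hs'),
    genFun_expParetoMixedPoi hlam hε (hs0.trans hss') hs']
  refine integral_mono (integrable_exp_expPareto hlam hε (by linarith))
    (integrable_exp_expPareto hlam hε (by linarith)) fun t => ?_
  have := expPareto_nonneg hlam.le hε.le t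
  dsimp only
  gcongr

/-- Bound the exponential by its value at the minimum of the mixing variable; the remaining factor
`X` has mean `lam`, which cancels. -/
lemma genFun_downshiftedSizeBias_le {lam ε s : ℝ} (hlam : 0 < lam) (hε : 0 ≤ ε) (hε1 : ε < 1)
    (hs0 : 0 ≤ s) (hs1 : s ≤ 1) :
    genFun (downshiftedSizeBias (expParetoMixedPoi lam ε)) s ≤
      Real.exp (-(lam * (1 - ε) * (1 - s))) := by
  have hu : 0 ≤ 1 - s := sub_nonneg.2 hs1
  have hX := integrable_expPareto lam hε1
  rw [genFun_downshiftedSizeBias_expParetoMixedPoi hlam hε1 hs0 hs1, div_le_iff₀ hlam]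
  calc _ ≤ ∫ t, expPareto lam ε t * Real.exp (-(lam * (1 - ε) * (1 - s))) ∂(expMeasure 1) := by
        refine integral_mono_ae (integrable_expPareto_mul_exp hlam hε1 hu)
          (hX.1.mul_const _) ?_
        filter_upwards [ae_nonneg_expMeasure_one] with t ht
        have h1 := expPareto_nonneg hlam.le hε1.le t
        have h2 := le_expPareto hlam.le hε hε1.le ht
        gcongr
    _ = _ := by rw [integral_mul_const, hX.2, mul_comm]

/-- Monotonicity of `ζ_CM` along the Pareto family, as long as the minimal value
`lam (1 - ε₀)` of the mixing variable exceeds `2 / (1 - e⁻²)`. -/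
lemma zetaCM_expParetoMixedPoi_anti {lam ε₀ ε ε' : ℝ} (hlam : 0 < lam)
    (hε₀ : 2 / (1 - Real.exp (-2)) ≤ lam * (1 - ε₀)) (hε : 0 ≤ ε) (hεε' : ε ≤ ε')
    (hε' : ε' ≤ ε₀) :
    zetaCM (expParetoMixedPoi lam ε') ≤ zetaCM (expParetoMixedPoi lam ε) := by
  have he : 0 < 1 - Real.exp (-2) := sub_pos.2 (Real.exp_lt_one_iff.2 (by norm_num))
  have hc : 0 < lam * (1 - ε₀) := (by positivity : (0 : ℝ) < 2 / (1 - Real.exp (-2))).trans_le hε₀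
  have hε₀1 : ε₀ < 1 := sub_pos.1 (pos_of_mul_pos_right hc hlam.le)
  have hε'1 : ε' < 1 := hε'.trans_lt hε₀1
  have hcc : lam * (1 - ε₀) ≤ lam * (1 - ε') := by gcongr
  -- Smallest `u` for which `x e^{-ux}` is convex on `[lam (1 - ε₀), ∞)`.
  set u := 2 / (lam * (1 - ε₀)) with hu
  have hu0 : 0 ≤ u := by positivity
  have hule : u ≤ 1 - Real.exp (-2) := by
    rw [hu, div_le_iff₀ hc, mul_comm]
    exact (div_le_iff₀ he).1 hε₀
  have hcu : 2 ≤ lam * (1 - ε') * u := by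
    calc 2 = lam * (1 - ε₀) * u := by rw [hu, mul_div_cancel₀ _ hc.ne']
      _ ≤ _ := by gcongr
  have hexp := Real.exp_pos (-2)
  have hs : 1 - u ∈ Set.Icc (0 : ℝ) 1 := ⟨by linarith, by linarith⟩
  have hG' : genFun (downshiftedSizeBias (expParetoMixedPoi lam ε')) (1 - u) ≤ 1 - u := by
    refine (genFun_downshiftedSizeBias_le hlam (hε.trans hεε') hε'1 hs.1 hs.2).trans ?_
    rw [sub_sub_cancel]
    calc Real.exp (-(lam * (1 - ε') * u)) ≤ Real.exp (-2) := by gcongr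
      _ ≤ 1 - u := by linarith
  obtain ⟨h0, h1, h2⟩ := extinctionProb_spec
    (continuousOn_genFun_downshiftedSizeBias hlam hε'1) hs hG'
  set η' := extinctionProb (downshiftedSizeBias (expParetoMixedPoi lam ε')) with hη'
  have hη'1 : η' ≤ 1 := h1.trans hs.2
  -- Comparison at the extinction probability `η'` of the larger parameter: it lies in the convexity
  -- range, so the smaller generating function is at most `η'` there and has a fixed point no
  -- larger.
  have hG : genFun (downshiftedSizeBias (expParetoMixedPoi lam ε)) η' ≤ η' := by
    refine (genFun_downshiftedSizeBias_mono hlam hε hεε' hε'1 h0 hη'1 ?_).trans h2.le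
    refine hcu.trans ?_
    have : u ≤ 1 - η' := by linarith
    have := hc.le.trans hcc
    gcongr
  obtain ⟨h3, h4, -⟩ := extinctionProb_spec
    (continuousOn_genFun_downshiftedSizeBias hlam (hεε'.trans_lt hε'1)) ⟨h0, hη'1⟩ hG
  rw [zetaCM, zetaCM, ← hη']
  exact sub_le_sub_left ((genFun_expParetoMixedPoi_monotone hlam (hεε'.trans_lt hε'1) h3 h4
    hη'1).trans (genFun_expParetoMixedPoi_mono hlam hε hεε' hε'1 h0 hη'1)) 1

end BranchingCM

theorem mainTheorem2 (lam : ℝ) (hlam : BranchingCM.lambdaCr < lam) :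
    ∃ αcr : ℝ, 1 < αcr ∧ ∀ α β : ℝ, αcr ≤ α → α ≤ β →
      BranchingCM.zetaCM (BranchingCM.paretoMixedPoi lam α) ≤
          BranchingCM.zetaCM (BranchingCM.paretoMixedPoi lam β) ∧
        BranchingCM.zetaCM (BranchingCM.paretoMixedPoi lam β) ≤
          BranchingCM.zetaCM (BranchingCM.poi lam) := by
  have he : 0 < 1 - Real.exp (-2) := sub_pos.2 (Real.exp_lt_one_iff.2 (by norm_num))
  set c := 2 / (1 - Real.exp (-2)) with hc
  have hc0 : 0 < c := by positivity
  have hclam : c < lam := BranchingCM.le_lambdaCr.trans_lt hlam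
  have hl : 0 < lam := hc0.trans hclam
  have hlc : 0 < lam - c := sub_pos.2 hclam
  have hα₀ : 1 < lam / (lam - c) := (one_lt_div hlc).2 (by linarith)
  -- This `αcr` solves `lam (1 - 1/αcr) = c`: the Pareto scale is then exactly the threshold.
  refine ⟨lam / (lam - c), hα₀, fun α β hα hαβ => ?_⟩
  have hε₀ : c ≤ lam * (1 - 1 / (lam / (lam - c))) := by
    rw [one_div_div, mul_sub, mul_div_cancel₀ _ hl.ne']
    linarith
  have hα1 : 1 < α := hα₀.trans_le hα
  have hβ1 : 1 < β := hα1.trans_le hαβ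
  rw [← BranchingCM.expParetoMixedPoi_one_div hl hα1,
    ← BranchingCM.expParetoMixedPoi_one_div hl hβ1, ← BranchingCM.expParetoMixedPoi_zero]
  have hβ0 : 0 ≤ 1 / β := by positivity
  have hβα : 1 / β ≤ 1 / α := one_div_le_one_div_of_le (by linarith) hαβ
  have hα' : 1 / α ≤ 1 / (lam / (lam - c)) := one_div_le_one_div_of_le (by linarith) hα
  exact ⟨BranchingCM.zetaCM_expParetoMixedPoi_anti hl hε₀ hβ0 hβα hα',
    BranchingCM.zetaCM_expParetoMixedPoi_anti hl hε₀ le_rfl hβ0 (hβα.trans hα')⟩
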